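/- Let $c>0$. There is a constant $A$ depending only on $c$ such that the following holds for every real $\alpha\ge -1/2$. Let $J_\alpha(x)=\sum_{k\ge 0}\frac{(-1)^k}{k!\,\Gamma(k+\alpha+1)}\left(\frac x2\right)^{2k+\alpha}$ be the Bessel function of the first kind of order $\alpha$, let $\mathcal H_c^\alpha$ be the finite Hankel transform on $L^2(0,1)$, $$\mathcal H_c^\alpha f(x)=\int_0^1\sqrt{cxy}\,J_\alpha(cxy)\,f(y)\,dy ,$$ and let $\lambda_0^\alpha(c)\ge\lambda_1^\alpha(c)\ge\cdots$ be the eigenvalues, listed in nonincreasing order and with multiplicity, of the positive self-adjoint compact operator $\mathcal Q_c^\alpha=c\,\mathcal H_c^\alpha\mathcal H_c^\alpha$ on $L^2(0,1)$. Then for every integer $n>\frac{ec}{4}$, $$\lambda_n^\alpha(c)\le A\left(\frac{ec}{4n+2\alpha+5}\right)^{2n+\alpha+1}.$$ -/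

import Mathlib

open MeasureTheory Set

namespace FiniteHankel

noncomputable section

/-- The Bessel function of the first kind and order `α`, given by its power series
`J_α(x) = ∑ (-1)^n / (n! Γ(n+α+1)) (x/2)^(2n+α)`; it is used for `x > 0` and `α ≥ -1/2`. -/
def besselJ (α x : ℝ) : ℝ :=
  ∑' n : ℕ, (-1) ^ n / (n.factorial * Real.Gamma (n + α + 1)) * (x / 2) ^ (2 * (n : ℝ) + α)

/-- The kernel `√(cxy) J_α(cxy)` of the finite Hankel transform. -/
def hankelKernel (α c x y : ℝ) : ℝ :=
  √(c * x * y) * besselJ α (c * x * y)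

/-- Lebesgue measure on the interval `(0, 1)`. -/
abbrev μI : Measure ℝ := volume.restrict (Ioo (0 : ℝ) 1)

/-- The real Hilbert space `L²(0, 1)`. -/
abbrev L2I : Type := Lp ℝ 2 μI

instance : IsProbabilityMeasure μI := ⟨by simp⟩

/-- Boundedness and measurability of a kernel on `(0, 1) × (0, 1)`. -/
structure IsBoundedKernel (K : ℝ → ℝ → ℝ) : Prop where
  aestronglyMeasurable : AEStronglyMeasurable (Function.uncurry K) (μI.prod μI)
  bound : ∃ C : ℝ, 0 ≤ C ∧ ∀ x ∈ Ioo (0 : ℝ) 1, ∀ y ∈ Ioo (0 : ℝ) 1, |K x y| ≤ C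

theorem L2I.integrable (f : L2I) : Integrable f μI :=
  (Lp.memLp f).integrable (by norm_num)

theorem L2I.integral_norm_le (f : L2I) : ∫ y, ‖f y‖ ∂μI ≤ ‖f‖ := by
  rw [integral_norm_eq_lintegral_enorm (Lp.aestronglyMeasurable f), ← eLpNorm_one_eq_lintegral_enorm,
    Lp.norm_def]
  exact ENNReal.toReal_mono (Lp.eLpNorm_ne_top f)
    (eLpNorm_le_eLpNorm_of_exponent_le (by norm_num) (Lp.aestronglyMeasurable f))

theorem ae_mem_Ioo : ∀ᵐ x ∂μI, x ∈ Ioo (0 : ℝ) 1 := ae_restrict_mem measurableSet_Ioo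

theorem IsBoundedKernel.ae_integrable {K : ℝ → ℝ → ℝ} (hK : IsBoundedKernel K) (f : L2I) :
    ∀ᵐ x ∂μI, Integrable (fun y => K x y * f y) μI := by
  obtain ⟨C, -, hC⟩ := hK.bound
  filter_upwards [hK.aestronglyMeasurable.prodMk_left, ae_mem_Ioo] with x hx hx'
  refine (L2I.integrable f).bdd_mul (c := C) hx ?_
  filter_upwards [ae_mem_Ioo] with y hy
  exact hC x hx' y hy

theorem IsBoundedKernel.norm_integral_le {K : ℝ → ℝ → ℝ} {C : ℝ} (h0 : 0 ≤ C)
    (hC : ∀ x ∈ Ioo (0 : ℝ) 1, ∀ y ∈ Ioo (0 : ℝ) 1, |K x y| ≤ C) (f : L2I) :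
    ∀ᵐ x ∂μI, ‖∫ y, K x y * f y ∂μI‖ ≤ C * ‖f‖ := by
  filter_upwards [ae_mem_Ioo] with x hx
  calc ‖∫ y, K x y * f y ∂μI‖ ≤ ∫ y, C * ‖f y‖ ∂μI := by
        refine norm_integral_le_of_norm_le ((L2I.integrable f).norm.const_mul C) ?_
        filter_upwards [ae_mem_Ioo] with y hy
        rw [norm_mul]
        exact mul_le_mul_of_nonneg_right (hC x hx y hy) (norm_nonneg _)
    _ ≤ C * ‖f‖ := by
        rw [integral_const_mul]
        exact mul_le_mul_of_nonneg_left (L2I.integral_norm_le f) h0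

theorem IsBoundedKernel.memLp {K : ℝ → ℝ → ℝ} (hK : IsBoundedKernel K) (f : L2I) :
    MemLp (fun x => ∫ y, K x y * f y ∂μI) 2 μI := by
  obtain ⟨C, h0, hC⟩ := hK.bound
  refine MemLp.of_bound ?_ (C * ‖f‖) (IsBoundedKernel.norm_integral_le h0 hC f)
  have h : AEStronglyMeasurable (fun z : ℝ × ℝ => Function.uncurry K z * f z.2) (μI.prod μI) :=
    hK.aestronglyMeasurable.mul (Lp.aestronglyMeasurable f).comp_snd
  exact h.integral_prod_right'

/-- The integral operator `f ↦ ∫₀¹ K(·, y) f(y) dy` on `L²(0, 1)` with a bounded measurable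
kernel `K`. -/
def integralOperator (K : ℝ → ℝ → ℝ) (hK : IsBoundedKernel K) : L2I →L[ℝ] L2I :=
  LinearMap.mkContinuousOfExistsBound
    { toFun := fun f => (hK.memLp f).toLp (fun x => ∫ y, K x y * f y ∂μI)
      map_add' := fun f g => by
        rw [← MemLp.toLp_add]
        refine MemLp.toLp_congr _ _ ?_
        filter_upwards [hK.ae_integrable f, hK.ae_integrable g] with x hf hg
        rw [Pi.add_apply, ← integral_add hf hg]
        refine integral_congr_ae ?_
        filter_upwards [Lp.coeFn_add f g] with y hy
        rw [hy, Pi.add_apply, mul_add]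
      map_smul' := fun r f => by
        rw [RingHom.id_apply, ← MemLp.toLp_const_smul]
        refine MemLp.toLp_congr _ _ (Filter.Eventually.of_forall fun x => ?_)
        rw [Pi.smul_apply, ← integral_smul]
        refine integral_congr_ae ?_
        filter_upwards [Lp.coeFn_smul r f] with y hy
        rw [hy, Pi.smul_apply, smul_eq_mul, smul_eq_mul, mul_left_comm] }
    (by
      obtain ⟨C, h0, hC⟩ := hK.bound
      refine ⟨C, fun f => ?_⟩
      have h := Lp.norm_le_of_ae_bound (f := (hK.memLp f).toLp _) (mul_nonneg h0 (norm_nonneg f)) (by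
        filter_upwards [(hK.memLp f).coeFn_toLp, IsBoundedKernel.norm_integral_le h0 hC f]
          with x hx hx'
        rw [hx]
        exact hx')
      refine h.trans (le_of_eq ?_)
      have h1 : measureUnivNNReal μI = 1 := by simp [measureUnivNNReal]
      rw [h1, NNReal.coe_one, Real.one_rpow, one_mul])

theorem integralOperator_ae (K : ℝ → ℝ → ℝ) (hK : IsBoundedKernel K) (f : L2I) :
    ∀ᵐ x ∂μI, integralOperator K hK f x = ∫ y in Ioo (0 : ℝ) 1, K x y * f y :=
  (hK.memLp f).coeFn_toLp

theorem gamma_lower {α : ℝ} (hα : -1 / 2 ≤ α) (n : ℕ) :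
    Real.Gamma (α + 1) / 2 ≤ Real.Gamma (n + α + 1) := by
  have hpos : 0 < Real.Gamma (α + 1) := Real.Gamma_pos_of_pos (by linarith)
  rcases n with _ | n
  · simp only [Nat.cast_zero, zero_add]
    linarith
  induction n with
  | zero =>
    have h : ((0 + 1 : ℕ) : ℝ) + α + 1 = (α + 1) + 1 := by push_cast; ring
    rw [h, Real.Gamma_add_one (s := α + 1) (by linarith)]
    nlinarith
  | succ n ih =>
    have h : ((n + 1 + 1 : ℕ) : ℝ) + α + 1 = (((n + 1 : ℕ) : ℝ) + α + 1) + 1 := by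
      push_cast; ring
    have hn : (0 : ℝ) ≤ n := n.cast_nonneg
    have h1 : (1 : ℝ) ≤ ((n + 1 : ℕ) : ℝ) + α + 1 := by push_cast; linarith
    rw [h, Real.Gamma_add_one (s := ((n + 1 : ℕ) : ℝ) + α + 1) (by linarith)]
    nlinarith

/-- The even entire factor of the Bessel function, as a function of `t = (x/2)²`. -/
def besselSeries (α t : ℝ) : ℝ :=
  ∑' n : ℕ, (-1) ^ n / (n.factorial * Real.Gamma (n + α + 1)) * t ^ n

theorem besselSeries_term {α : ℝ} (hα : -1 / 2 ≤ α) {R t : ℝ} (ht : |t| ≤ R) (n : ℕ) :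
    ‖(-1) ^ n / (n.factorial * Real.Gamma (n + α + 1)) * t ^ n‖ ≤
      2 / Real.Gamma (α + 1) * (R ^ n / n.factorial) := by
  have hpos : 0 < Real.Gamma (α + 1) := Real.Gamma_pos_of_pos (by linarith)
  have hg := gamma_lower hα n
  have hf : (0 : ℝ) < n.factorial := by exact_mod_cast n.factorial_pos
  rw [norm_mul, norm_div, norm_mul, norm_pow, norm_pow, norm_neg, norm_one, one_pow,
    Real.norm_of_nonneg hf.le, Real.norm_of_nonneg (by linarith : 0 ≤ Real.Gamma (n + α + 1))]
  have h1 : 1 / (n.factorial * Real.Gamma (n + α + 1)) ≤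
      1 / (n.factorial * (Real.Gamma (α + 1) / 2)) :=
    one_div_le_one_div_of_le (by positivity) (mul_le_mul_of_nonneg_left hg hf.le)
  have h2 : ‖t‖ ^ n ≤ R ^ n := pow_le_pow_left₀ (norm_nonneg _) ht n
  calc _ ≤ 1 / (n.factorial * (Real.Gamma (α + 1) / 2)) * R ^ n :=
        mul_le_mul h1 h2 (by positivity) (by positivity)
    _ = _ := by field_simp

theorem continuousOn_besselSeries {α : ℝ} (hα : -1 / 2 ≤ α) (R : ℝ) :
    ContinuousOn (besselSeries α) (Icc (-R) R) := by
  refine continuousOn_tsum (u := fun n : ℕ => 2 / Real.Gamma (α + 1) * (R ^ n / (n.factorial : ℝ)))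
    (fun n => (continuous_const.mul (continuous_pow n)).continuousOn)
    ((Real.summable_pow_div_factorial R).mul_left _) ?_
  exact fun n t ht => besselSeries_term hα (abs_le.2 ht) n

theorem besselJ_eq {α x : ℝ} (hx : 0 < x) :
    besselJ α x = (x / 2) ^ α * besselSeries α ((x / 2) ^ 2) := by
  unfold besselJ besselSeries
  rw [← tsum_mul_left]
  refine tsum_congr fun n => ?_
  have h : (x / 2) ^ (2 * (n : ℝ) + α) = (x / 2) ^ α * ((x / 2) ^ 2) ^ n := by
    rw [Real.rpow_add (by positivity), ← pow_mul, ← Real.rpow_natCast (x / 2) (2 * n)]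
    push_cast
    ring
  rw [h]
  ring

theorem isBoundedKernel_hankelKernel {α c : ℝ} (hα : -1 / 2 ≤ α) (hc : 0 < c) :
    IsBoundedKernel (hankelKernel α c) := by
  have key : ∀ z : ℝ, 0 < z → √z * besselJ α z =
      √2 * ((z / 2) ^ (α + 1 / 2) * besselSeries α ((z / 2) ^ 2)) := by
    intro z hz
    rw [besselJ_eq hz, Real.rpow_add (by positivity), ← Real.sqrt_eq_rpow]
    have h : √z = √2 * √(z / 2) := by
      rw [← Real.sqrt_mul (by norm_num)]
      congr 1
      ring
    rw [h]
    ring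
  have hcont : ContinuousOn
      (fun z : ℝ => √2 * ((z / 2) ^ (α + 1 / 2) * besselSeries α ((z / 2) ^ 2))) (Icc 0 c) := by
    refine continuousOn_const.mul (ContinuousOn.mul ?_ ?_)
    · exact ((continuous_id.div_const 2).rpow_const fun _ => Or.inr (by linarith)).continuousOn
    · refine (continuousOn_besselSeries hα ((c / 2) ^ 2)).comp (by fun_prop) fun z hz => ?_
      have h1 : (z / 2) ^ 2 ≤ (c / 2) ^ 2 :=
        pow_le_pow_left₀ (by linarith [hz.1]) (by linarith [hz.2]) 2
      exact ⟨by nlinarith [sq_nonneg (z / 2), sq_nonneg (c / 2)], h1⟩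
  have hmem : ∀ x ∈ Ioo (0 : ℝ) 1, ∀ y ∈ Ioo (0 : ℝ) 1, 0 < c * x * y ∧ c * x * y ≤ c := by
    intro x hx y hy
    have hxy : x * y ≤ 1 := mul_le_one₀ hx.2.le hy.1.le hy.2.le
    refine ⟨mul_pos (mul_pos hc hx.1) hy.1, ?_⟩
    nlinarith
  constructor
  · rw [Measure.prod_restrict]
    have h : ContinuousOn (Function.uncurry (hankelKernel α c))
        (Ioo (0 : ℝ) 1 ×ˢ Ioo (0 : ℝ) 1) := by
      refine (hcont.comp (f := fun p : ℝ × ℝ => c * p.1 * p.2) (by fun_prop)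
        fun p hp => ?_).congr fun p hp => ?_
      · obtain ⟨h1, h2⟩ := hmem p.1 hp.1 p.2 hp.2
        exact ⟨h1.le, h2⟩
      · exact key _ (hmem p.1 hp.1 p.2 hp.2).1
    exact h.aestronglyMeasurable (measurableSet_Ioo.prod measurableSet_Ioo)
  · obtain ⟨C, hC⟩ := isCompact_Icc.exists_bound_of_continuousOn hcont
    refine ⟨max C 0, le_max_right _ _, fun x hx y hy => ?_⟩
    obtain ⟨h1, h2⟩ := hmem x hx y hy
    have := hC _ ⟨h1.le, h2⟩
    rw [← key _ h1] at this
    exact this.trans (le_max_left _ _)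

/-- The finite Hankel transform `H_c^α f (x) = ∫₀¹ √(cxy) J_α(cxy) f(y) dy` on `L²(0, 1)`. -/
def hankelOp (α c : ℝ) (hα : -1 / 2 ≤ α) (hc : 0 < c) : L2I →L[ℝ] L2I :=
  integralOperator (hankelKernel α c) (isBoundedKernel_hankelKernel hα hc)

/-- The operator `Q_c^α = c H_c^α H_c^α` on `L²(0, 1)`. -/
def Q (α c : ℝ) (hα : -1 / 2 ≤ α) (hc : 0 < c) : L2I →L[ℝ] L2I :=
  c • (hankelOp α c hα hc ∘L hankelOp α c hα hc)

/-- The `n`-th eigenvalue (`n = 0, 1, 2, …`) in the nonincreasing enumeration, with multiplicity,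
of the eigenvalues of a positive self-adjoint compact operator `T`: the greatest eigenvalue `t`
such that at least `n + 1` eigenvalues of `T`, counted with multiplicity, are `≥ t`. -/
def eigenvalueSeq {E : Type*} [NormedAddCommGroup E] [InnerProductSpace ℝ E]
    (T : E →L[ℝ] E) (n : ℕ) : ℝ :=
  sSup {t : ℝ | Module.End.HasEigenvalue (T : Module.End ℝ E) t ∧
    ((n + 1 : ℕ) : Cardinal) ≤
      Module.rank ℝ ↥(⨆ s ∈ Ici t, Module.End.eigenspace (T : Module.End ℝ E) s)}

/-- The eigenvalues `λ_0^α(c) ≥ λ_1^α(c) ≥ …` of `Q_c^α`. -/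
def eigenvalue (α c : ℝ) (hα : -1 / 2 ≤ α) (hc : 0 < c) (n : ℕ) : ℝ :=
  eigenvalueSeq (Q α c hα hc) n

end

end FiniteHankel

/-!
The operator `Q = c H H`, with `H` the finite Hankel transform, satisfies `⟪Q f, f⟫ = c ‖H f‖²`
because the kernel of `H` is symmetric. By the min-max principle (`eigenvalueSeq_le`), the
eigenvalue of index `n` is therefore at most the supremum of `c ‖H f‖²` over unit vectors `f`
orthogonal to any `n` prescribed functions.

The prescribed functions are `y ^ (α + 1/2 + 2k)` for `k < n`, the dependence on `y` of the first
`n` terms of the power series of the kernel `√(cxy) J_α(cxy)`. On their orthogonal complement only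
the remainder of the series acts, and its size is that of its first term
(`norm_hankelOp_le_of_orthogonal`). With `N = 2n + α + 1` this gives
`λ_n ≤ 16 e^(c²/2) ((c/2)^N / (n! Γ(n+α+1)))²` (`eigenvalue_le`).

Since `n! Γ(n+α+1)` is at least `N^N` up to an exponential factor and a power of `N`, this is at
most `(C/N)^(2N)` up to powers of `N`, which is far below `(ec/(2N+3))^N`: their quotient is at
most a constant times `(C'/N)^N`, which is bounded in `N`, uniformly in `α`
(`rpow_div_factorial_mul_Gamma_le`). The lower bound on the Gamma function is
`y^p e^(-y) ≤ Γ(p+1)` for every `y ≥ 0`, used for both factors with the same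
`y = 2N + 3 = 4n + 2α + 5`.
-/

namespace FiniteHankel

/-! ### The min-max principle -/

theorem mul_norm_sq_le_inner_of_mem_iSup_eigenspace {E : Type*} [NormedAddCommGroup E]
    [InnerProductSpace ℝ E] {T : E →L[ℝ] E} (hT : (T : E →ₗ[ℝ] E).IsSymmetric) {t : ℝ} {f : E}
    (hf : f ∈ ⨆ s ∈ Ici t, Module.End.eigenspace (T : Module.End ℝ E) s) :
    t * ‖f‖ ^ 2 ≤ inner ℝ (T f) f := by
  rw [iSup_subtype', Submodule.mem_iSup_iff_exists_finsupp] at hf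
  obtain ⟨v, hv, rfl⟩ := hf
  have horth := hT.orthogonalFamily_eigenspaces.comp (Subtype.val_injective (p := (· ∈ Ici t)))
  have hTv : T (v.sum fun _ x => x) = ∑ i ∈ v.support, (i : ℝ) • v i := by
    rw [Finsupp.sum, map_sum]
    exact Finset.sum_congr rfl fun i _ => Module.End.mem_eigenspace_iff.1 (hv i)
  have hnorm := horth.norm_sum (fun i => ⟨v i, hv i⟩) v.support
  have hinner := horth.inner_sum (fun i => ⟨(i : ℝ) • v i, Submodule.smul_mem _ _ (hv i)⟩)
    (fun i => ⟨v i, hv i⟩) v.support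
  simp only [Submodule.coe_subtypeₗᵢ, Submodule.coe_subtype, Submodule.coe_norm, Submodule.coe_inner] at hnorm hinner
  rw [hTv, Finsupp.sum, hnorm, hinner, Finset.mul_sum]
  refine Finset.sum_le_sum fun i _ => ?_
  rw [real_inner_smul_left, real_inner_self_eq_norm_sq]
  exact mul_le_mul_of_nonneg_right i.2 (sq_nonneg _)

/-- The upper half of the min-max principle: the quadratic form of `T` on the orthogonal complement
of `n` vectors bounds the eigenvalue of index `n`. -/
theorem eigenvalueSeq_le {E : Type*} [NormedAddCommGroup E] [InnerProductSpace ℝ E]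
    {T : E →L[ℝ] E} (hT : (T : E →ₗ[ℝ] E).IsSymmetric) {n : ℕ} {b : ℝ} (hb : 0 ≤ b)
    (w : Fin n → E) (h : ∀ f, (∀ k, inner ℝ (w k) f = 0) → inner ℝ (T f) f ≤ b * ‖f‖ ^ 2) :
    eigenvalueSeq T n ≤ b := by
  refine Real.sSup_le ?_ hb
  rintro t ⟨-, hrank⟩
  set V := ⨆ s ∈ Ici t, Module.End.eigenspace (T : Module.End ℝ E) s with hV
  let F : V →ₗ[ℝ] (Fin n → ℝ) := LinearMap.pi fun k => (innerₗ E (w k)).comp V.subtype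
  -- `V` has dimension at least `n + 1`, so `n` linear conditions leave a nonzero vector.
  have hF : ¬ Function.Injective F := by
    intro hinj
    have h1 := LinearMap.lift_rank_le_of_injective F hinj
    rw [rank_fin_fun] at h1
    have h2 := (Cardinal.lift_le.2 hrank).trans h1
    simp only [Cardinal.lift_natCast, Nat.cast_le] at h2
    omega
  rw [← LinearMap.ker_eq_bot, Submodule.eq_bot_iff] at hF
  push Not at hF
  obtain ⟨f, hf, hf0⟩ := hF
  have h1 : ∀ k, inner ℝ (w k) (f : E) = 0 := fun k => congrFun (LinearMap.mem_ker.1 hf) k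
  have h2 := mul_norm_sq_le_inner_of_mem_iSup_eigenspace hT f.2
  have h3 : 0 < ‖(f : E)‖ := norm_pos_iff.2 (by simpa using hf0)
  exact le_of_mul_le_mul_right (h2.trans (h _ h1)) (pow_pos h3 2)

/-! ### Symmetry of the operators -/

theorem isSymmetric_integralOperator {K : ℝ → ℝ → ℝ} (hK : IsBoundedKernel K)
    (hsymm : ∀ x y, K x y = K y x) :
    (integralOperator K hK : L2I →ₗ[ℝ] L2I).IsSymmetric := by
  intro f g
  obtain ⟨C, -, hC⟩ := hK.bound
  have hint : Integrable (Function.uncurry fun x y => K x y * (f y * g x)) (μI.prod μI) := by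
    have h := (L2I.integrable g).mul_prod (L2I.integrable f)
    have h' : Integrable (fun z : ℝ × ℝ => f z.2 * g z.1) (μI.prod μI) := by
      simpa only [mul_comm] using h
    refine h'.bdd_mul (c := C) (f := Function.uncurry K) hK.aestronglyMeasurable ?_
    rw [Measure.prod_restrict]
    filter_upwards [ae_restrict_mem (measurableSet_Ioo.prod measurableSet_Ioo)] with z hz
    exact hC _ hz.1 _ hz.2
  rw [L2.inner_def, L2.inner_def]
  calc ∫ x, inner ℝ (integralOperator K hK f x) (g x) ∂μI
      = ∫ x, ∫ y, K x y * (f y * g x) ∂μI ∂μI := by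
        refine integral_congr_ae ?_
        filter_upwards [integralOperator_ae K hK f] with x hx
        rw [hx, real_inner_comm]
        simp only [← mul_assoc]
        rw [integral_mul_const]
        simp
    _ = ∫ y, ∫ x, K x y * (f y * g x) ∂μI ∂μI := integral_integral_swap hint
    _ = ∫ y, inner ℝ (f y) (integralOperator K hK g y) ∂μI := by
        refine integral_congr_ae ?_
        filter_upwards [integralOperator_ae K hK g] with y hy
        rw [hy, real_inner_comm]
        simp only [hsymm _ y, mul_left_comm _ (f y)]
        rw [integral_const_mul]
        simp

theorem hankelKernel_symm (α c x y : ℝ) : hankelKernel α c x y = hankelKernel α c y x := by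
  simp only [hankelKernel, mul_right_comm c x y]

theorem isSymmetric_hankelOp {α c : ℝ} (hα : -1 / 2 ≤ α) (hc : 0 < c) :
    (hankelOp α c hα hc : L2I →ₗ[ℝ] L2I).IsSymmetric :=
  isSymmetric_integralOperator _ (hankelKernel_symm α c)

theorem isSymmetric_Q {α c : ℝ} (hα : -1 / 2 ≤ α) (hc : 0 < c) :
    (Q α c hα hc : L2I →ₗ[ℝ] L2I).IsSymmetric := by
  have h := isSymmetric_hankelOp hα hc
  intro f g
  change inner ℝ (c • hankelOp α c hα hc (hankelOp α c hα hc f)) g =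
    inner ℝ f (c • hankelOp α c hα hc (hankelOp α c hα hc g))
  rw [real_inner_smul_left, real_inner_smul_right]
  exact congrArg (c * ·) ((h _ _).trans (h _ _))

theorem inner_Q_self {α c : ℝ} (hα : -1 / 2 ≤ α) (hc : 0 < c) (f : L2I) :
    inner ℝ (Q α c hα hc f) f = c * ‖hankelOp α c hα hc f‖ ^ 2 := by
  change inner ℝ (c • hankelOp α c hα hc (hankelOp α c hα hc f)) f = _
  rw [real_inner_smul_left, ← real_inner_self_eq_norm_sq]
  exact congrArg (c * ·) (isSymmetric_hankelOp hα hc _ _)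

/-! ### The power series of the kernel -/

/-- The coefficients of `besselSeries`. -/
noncomputable def besselCoeff (α : ℝ) (k : ℕ) : ℝ :=
  (-1) ^ k / (k.factorial * Real.Gamma (k + α + 1))

theorem abs_besselCoeff_add_le {α : ℝ} (hα : -1 / 2 ≤ α) (n j : ℕ) :
    |besselCoeff α (j + n)| ≤ 2 / (n.factorial * Real.Gamma (n + α + 1)) / j.factorial := by
  have hn : (0 : ℝ) ≤ n := n.cast_nonneg
  have hG : 0 < Real.Gamma (n + α + 1) := by
    rcases n with _ | n
    · exact Real.Gamma_pos_of_pos (by push_cast; linarith)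
    · exact Real.Gamma_pos_of_pos (by push_cast; linarith)
  have hg := gamma_lower (α := n + α) (by linarith) j
  have hg' : Real.Gamma (n + α + 1) / 2 ≤ Real.Gamma ((j + n : ℕ) + α + 1) := by
    rw [show ((j + n : ℕ) : ℝ) + α + 1 = j + (n + α) + 1 by push_cast; ring]
    exact hg
  have hf : (j.factorial * n.factorial : ℝ) ≤ (j + n).factorial := by
    exact_mod_cast Nat.le_of_dvd (Nat.factorial_pos _) (Nat.factorial_mul_factorial_dvd_factorial_add j n)
  have hj : (0 : ℝ) < j.factorial := by exact_mod_cast j.factorial_pos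
  have hnf : (0 : ℝ) < n.factorial := by exact_mod_cast n.factorial_pos
  have hG' : 0 < Real.Gamma ((j + n : ℕ) + α + 1) := by linarith
  rw [besselCoeff, abs_div, abs_pow, abs_neg, abs_one, one_pow, abs_of_nonneg (by positivity)]
  calc 1 / ((j + n).factorial * Real.Gamma ((j + n : ℕ) + α + 1))
      ≤ 1 / ((j.factorial * n.factorial) * (Real.Gamma (n + α + 1) / 2)) :=
        one_div_le_one_div_of_le (by positivity) (by gcongr)
    _ = _ := by field_simp

theorem abs_besselSeries_sub_sum_le {α : ℝ} (hα : -1 / 2 ≤ α) (n : ℕ) {t : ℝ} (ht : 0 ≤ t) :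
    |besselSeries α t - ∑ k ∈ Finset.range n, besselCoeff α k * t ^ k| ≤
      2 / (n.factorial * Real.Gamma (n + α + 1)) * t ^ n * Real.exp t := by
  have hs : Summable fun k => besselCoeff α k * t ^ k :=
    .of_norm_bounded ((Real.summable_pow_div_factorial t).mul_left _)
      fun k => besselSeries_term hα (abs_of_nonneg ht).le k
  have h1 : besselSeries α t - ∑ k ∈ Finset.range n, besselCoeff α k * t ^ k =
      ∑' j : ℕ, besselCoeff α (j + n) * t ^ (j + n) := by
    rw [sub_eq_iff_eq_add', hs.sum_add_tsum_nat_add n]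
    rfl
  have hexp : HasSum (fun j : ℕ => t ^ j / (j.factorial : ℝ)) (Real.exp t) := by
    rw [Real.exp_eq_exp_ℝ, NormedSpace.exp_eq_tsum_div]
    exact (Real.summable_pow_div_factorial t).hasSum
  rw [h1]
  rw [← Real.norm_eq_abs]
  refine tsum_of_norm_bounded (hexp.mul_left _) fun j => ?_
  rw [norm_mul, norm_pow, Real.norm_eq_abs, Real.norm_of_nonneg ht]
  calc _ ≤ 2 / (n.factorial * Real.Gamma (n + α + 1)) / j.factorial * t ^ (j + n) :=
        mul_le_mul_of_nonneg_right (abs_besselCoeff_add_le hα n j) (by positivity)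
    _ = _ := by ring

/-! ### The transform on the complement of monomials -/

/-- The sum of the first `n` terms of the power series of the Hankel kernel; it is a kernel of
rank at most `n`. -/
noncomputable def truncatedKernel (α c : ℝ) (n : ℕ) (x y : ℝ) : ℝ :=
  ∑ k ∈ Finset.range n, √2 * (c / 2) ^ (α + 1 / 2) * x ^ (α + 1 / 2) * besselCoeff α k *
    (c * x / 2) ^ (2 * k) * (y ^ (α + 1 / 2) * y ^ (2 * k))

theorem abs_hankelKernel_sub_truncatedKernel_le {α c : ℝ} (hα : -1 / 2 ≤ α) (hc : 0 < c) (n : ℕ)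
    {x y : ℝ} (hx : x ∈ Ioo (0 : ℝ) 1) (hy : y ∈ Ioo (0 : ℝ) 1) :
    |hankelKernel α c x y - truncatedKernel α c n x y| ≤
      √2 * (c / 2) ^ (α + 1 / 2) * (2 / (n.factorial * Real.Gamma (n + α + 1)) *
        ((c / 2) ^ 2) ^ n * Real.exp ((c / 2) ^ 2)) := by
  obtain ⟨hx0, hx1⟩ := hx
  obtain ⟨hy0, hy1⟩ := hy
  have hxy : x * y ≤ 1 := mul_le_one₀ hx1.le hy0.le hy1.le
  set z := c * x * y / 2 with hz
  have hz0 : 0 < z := by positivity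
  have hzc : z ≤ c / 2 := by
    rw [hz]
    nlinarith
  have hK : hankelKernel α c x y = √2 * z ^ (α + 1 / 2) * besselSeries α (z ^ 2) := by
    have h : √(c * x * y) = √2 * √z := by
      rw [← Real.sqrt_mul (by norm_num)]
      congr 1
      rw [hz]
      ring
    rw [hankelKernel, besselJ_eq (by positivity), h, Real.rpow_add hz0, ← Real.sqrt_eq_rpow]
    ring
  have hP : truncatedKernel α c n x y =
      √2 * z ^ (α + 1 / 2) * ∑ k ∈ Finset.range n, besselCoeff α k * (z ^ 2) ^ k := by
    rw [truncatedKernel, Finset.mul_sum]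
    refine Finset.sum_congr rfl fun k _ => ?_
    have h1 : z ^ (α + 1 / 2) = (c / 2) ^ (α + 1 / 2) * x ^ (α + 1 / 2) * y ^ (α + 1 / 2) := by
      rw [← Real.mul_rpow (by positivity) hx0.le, ← Real.mul_rpow (by positivity) hy0.le, hz]
      congr 1
      ring
    rw [h1, ← pow_mul, hz]
    ring
  have hp : 0 ≤ α + 1 / 2 := by linarith
  have hz2 : z ^ 2 ≤ (c / 2) ^ 2 := by gcongr
  have hG : 0 ≤ Real.Gamma (n + α + 1) :=
    Real.Gamma_nonneg_of_nonneg (by linarith [n.cast_nonneg (α := ℝ)])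
  rw [hK, hP, ← mul_sub, abs_mul, abs_of_nonneg (by positivity)]
  refine mul_le_mul (by gcongr) ?_ (abs_nonneg _) (by positivity)
  refine (abs_besselSeries_sub_sum_le hα n (sq_nonneg z)).trans ?_
  gcongr

theorem memLp_monomial {p : ℝ} (hp : 0 ≤ p) (k : ℕ) :
    MemLp (fun y : ℝ => y ^ p * y ^ k) 2 μI := by
  refine MemLp.of_bound ((measurable_id.pow_const p).mul
    (measurable_id.pow_const k)).aestronglyMeasurable 1 ?_
  filter_upwards [ae_mem_Ioo] with y hy
  rw [norm_mul, norm_pow, Real.norm_of_nonneg hy.1.le,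
    Real.norm_of_nonneg (Real.rpow_nonneg hy.1.le _)]
  exact mul_le_one₀ (Real.rpow_le_one hy.1.le hy.2.le hp) (pow_nonneg hy.1.le _)
    (pow_le_one₀ hy.1.le hy.2.le)

/-- On functions orthogonal to `y ^ (α + 1/2 + 2k)`, `k < n`, the Hankel transform is the
integral operator of the remainder of its kernel, which is small. -/
theorem norm_hankelOp_le_of_orthogonal {α c : ℝ} (hα : -1 / 2 ≤ α) (hc : 0 < c) {n : ℕ} {f : L2I}
    (hf : ∀ k : Fin n, inner ℝ
      ((memLp_monomial (p := α + 1 / 2) (by linarith) (2 * k)).toLp _ : L2I) f = 0) :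
    ‖hankelOp α c hα hc f‖ ≤ √2 * (c / 2) ^ (α + 1 / 2) *
      (2 / (n.factorial * Real.Gamma (n + α + 1)) *
        ((c / 2) ^ 2) ^ n * Real.exp ((c / 2) ^ 2)) * ‖f‖ := by
  set B := √2 * (c / 2) ^ (α + 1 / 2) * (2 / (n.factorial * Real.Gamma (n + α + 1)) *
        ((c / 2) ^ 2) ^ n * Real.exp ((c / 2) ^ 2)) with hB
  have hG : 0 ≤ Real.Gamma (n + α + 1) :=
    Real.Gamma_nonneg_of_nonneg (by linarith [n.cast_nonneg (α := ℝ)])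
  have hB0 : 0 ≤ B := by positivity
  have hmem := fun k : ℕ => memLp_monomial (p := α + 1 / 2) (by linarith) (2 * k)
  have hint : ∀ k : ℕ, Integrable (fun y => y ^ (α + 1 / 2) * y ^ (2 * k) * f y) μI :=
    fun k => (hmem k).integrable_mul (Lp.memLp f)
  have hzero : ∀ k < n, ∫ y, y ^ (α + 1 / 2) * y ^ (2 * k) * f y ∂μI = 0 := by
    intro k hk
    rw [← hf ⟨k, hk⟩, L2.inner_def]
    refine integral_congr_ae ?_
    filter_upwards [(hmem k).coeFn_toLp] with y hy
    rw [hy]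
    simp [mul_comm]
  have hPint : ∀ x, Integrable (fun y => truncatedKernel α c n x y * f y) μI := by
    intro x
    simp only [truncatedKernel, Finset.sum_mul, mul_assoc]
    refine integrable_finsetSum _ fun k _ => ?_
    simpa only [mul_assoc] using (hint k).const_mul
      (√2 * (c / 2) ^ (α + 1 / 2) * x ^ (α + 1 / 2) * besselCoeff α k * (c * x / 2) ^ (2 * k))
  have hPzero : ∀ x, ∫ y, truncatedKernel α c n x y * f y ∂μI = 0 := by
    intro x
    have h : ∀ y, truncatedKernel α c n x y * f y = ∑ k ∈ Finset.range n,
        √2 * (c / 2) ^ (α + 1 / 2) * x ^ (α + 1 / 2) * besselCoeff α k * (c * x / 2) ^ (2 * k) *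
          (y ^ (α + 1 / 2) * y ^ (2 * k) * f y) := by
      intro y
      rw [truncatedKernel, Finset.sum_mul]
      exact Finset.sum_congr rfl fun k _ => by ring
    simp only [h]
    rw [integral_finsetSum _ fun k _ => (hint k).const_mul _]
    refine Finset.sum_eq_zero fun k hk => ?_
    rw [integral_const_mul, hzero k (Finset.mem_range.1 hk), mul_zero]
  have hae : ∀ᵐ x ∂μI, ‖hankelOp α c hα hc f x‖ ≤ B * ‖f‖ := by
    filter_upwards [integralOperator_ae _ (isBoundedKernel_hankelKernel hα hc) f,
      (isBoundedKernel_hankelKernel hα hc).ae_integrable f,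
      IsBoundedKernel.norm_integral_le hB0 (fun x hx y hy =>
        abs_hankelKernel_sub_truncatedKernel_le hα hc n hx hy) f] with x hx hxi hxb
    rw [hankelOp, hx]
    convert hxb using 2
    simp only [sub_mul]
    rw [integral_sub hxi (hPint x), hPzero, sub_zero]
  refine (Lp.norm_le_of_ae_bound (by positivity) hae).trans (le_of_eq ?_)
  have h1 : measureUnivNNReal μI = 1 := by simp [measureUnivNNReal]
  rw [h1, NNReal.coe_one, Real.one_rpow, one_mul]

/-- The min-max principle with the monomials `y ^ (α + 1/2 + 2k)`, `k < n`, as test functions. -/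
theorem eigenvalue_le {α c : ℝ} (hα : -1 / 2 ≤ α) (hc : 0 < c) (n : ℕ) :
    eigenvalue α c hα hc n ≤ 16 * Real.exp (c ^ 2 / 2) *
      ((c / 2) ^ (2 * (n : ℝ) + α + 1)) ^ 2 / (n.factorial * Real.Gamma (n + α + 1)) ^ 2 := by
  have hc2 : 0 < c / 2 := by positivity
  refine eigenvalueSeq_le (isSymmetric_Q hα hc) (by positivity)
    (fun k : Fin n => (memLp_monomial (p := α + 1 / 2) (by linarith) (2 * (k : ℕ))).toLp _)
    fun f hf => ?_
  rw [inner_Q_self]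
  have h := pow_le_pow_left₀ (norm_nonneg _) (norm_hankelOp_le_of_orthogonal hα hc hf) 2
  refine (mul_le_mul_of_nonneg_left h hc.le).trans (le_of_eq ?_)
  have h1 : (c / 2) ^ (2 * (n : ℝ) + α + 1) =
      (c / 2) ^ (α + 1 / 2) * ((c / 2) ^ 2) ^ n * √(c / 2) := by
    rw [Real.sqrt_eq_rpow, ← pow_mul, ← Real.rpow_natCast, ← Real.rpow_add hc2,
      ← Real.rpow_add hc2]
    congr 1
    push_cast
    ring
  have h2 : Real.exp (c ^ 2 / 2) = Real.exp ((c / 2) ^ 2) ^ 2 := by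
    rw [← Real.exp_nat_mul]
    congr 1
    push_cast
    ring
  rw [h1, h2]
  simp only [mul_pow, div_pow (2 : ℝ), Real.sq_sqrt (zero_le_two (α := ℝ)), Real.sq_sqrt hc2.le]
  ring

/-! ### Lower bounds for the Gamma function and comparison of the bounds -/

/-- The part `∫_y^∞ s^p e^{-s} ds` of the Gamma integral is at least `y^p ∫_y^∞ e^{-s} ds`. -/
theorem rpow_mul_exp_neg_le_Gamma {p y : ℝ} (hp : 0 ≤ p) (hy : 0 ≤ y) :
    y ^ p * Real.exp (-y) ≤ Real.Gamma (p + 1) := by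
  have hint := Real.GammaIntegral_convergent (s := p + 1) (by linarith)
  have hsub : Ioi y ⊆ Ioi 0 := Ioi_subset_Ioi hy
  rw [Real.Gamma_eq_integral (by linarith), ← integral_exp_neg_Ioi, ← integral_const_mul]
  calc ∫ x in Ioi y, y ^ p * Real.exp (-x)
      ≤ ∫ x in Ioi y, Real.exp (-x) * x ^ (p + 1 - 1) := by
        refine setIntegral_mono_on ((integrableOn_exp_neg_Ioi y).const_mul _)
          (hint.mono_set hsub) measurableSet_Ioi fun x hx => ?_
        rw [mul_comm, add_sub_cancel_right]
        have : y ≤ x := (mem_Ioi.1 hx).le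
        gcongr
    _ ≤ _ := by
        refine setIntegral_mono_set hint ?_ hsub.eventuallyLE
        filter_upwards [ae_restrict_mem measurableSet_Ioi] with x hx
        have : (0 : ℝ) < x := hx
        simp only [Pi.zero_apply]
        positivity

theorem rpow_mul_exp_le_factorial_mul_Gamma {α : ℝ} {n : ℕ} (h : 0 ≤ n + α) {y : ℝ} (hy : 0 < y) :
    y ^ (2 * n + α) * Real.exp (-(2 * y)) ≤ n.factorial * Real.Gamma (n + α + 1) := by
  have h1 := rpow_mul_exp_neg_le_Gamma (p := n) n.cast_nonneg hy.le
  have h2 := rpow_mul_exp_neg_le_Gamma h hy.le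
  rw [Real.Gamma_nat_eq_factorial] at h1
  calc y ^ (2 * n + α) * Real.exp (-(2 * y))
      = (y ^ (n : ℝ) * Real.exp (-y)) * (y ^ (n + α) * Real.exp (-y)) := by
        rw [show 2 * (n : ℝ) + α = n + (n + α) by ring, Real.rpow_add hy,
          show -(2 * y) = -y + -y by ring, Real.exp_add]
        ring
    _ ≤ _ := mul_le_mul h1 h2 (by positivity) (by positivity)

/-- In terms of `N = 2n + α + 1` and `L = 2N + 3`, the left-hand side is at most a constant times
`(ec/L)^N (D/L)^N` with `D` depending only on `c`, and `(D/L)^N` is bounded because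
`D/L ≤ e^(D/L)` and `N ≤ L`. -/
theorem rpow_div_factorial_mul_Gamma_le {α c : ℝ} (hα : -1 / 2 ≤ α) (hc : 0 < c) {n : ℕ}
    (hn : 1 ≤ n) :
    ((c / 2) ^ (2 * (n : ℝ) + α + 1)) ^ 2 / (n.factorial * Real.Gamma (n + α + 1)) ^ 2 ≤
      2 * Real.exp 15 * Real.exp (c * Real.exp 9 / 4) *
        (Real.exp 1 * c / (4 * (n : ℝ) + 2 * α + 5)) ^ (2 * (n : ℝ) + α + 1) := by
  have hn' : (1 : ℝ) ≤ n := by exact_mod_cast hn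
  set N := 2 * (n : ℝ) + α + 1 with hN
  set L := 4 * (n : ℝ) + 2 * α + 5 with hL
  have hLN : L = 2 * N + 3 := by rw [hL, hN]; ring
  have hN0 : 0 < N := by linarith
  have hL0 : 0 < L := by linarith
  set D := c * Real.exp 9 / 4 with hD
  -- The choice `y = L` turns the Gamma factors into a power of the denominator of the claim.
  have hF := rpow_mul_exp_le_factorial_mul_Gamma (α := α) (n := n) (by linarith) hL0
  have hF' : L ^ N / L * Real.exp (-(2 * L)) ≤ n.factorial * Real.Gamma (n + α + 1) := by
    rwa [← Real.rpow_sub_one hL0.ne', hN, add_sub_cancel_right]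
  have hD1 : (D / L) ^ N ≤ Real.exp D := by
    calc (D / L) ^ N ≤ Real.exp (D / L) ^ N := by
          refine Real.rpow_le_rpow (by positivity) ?_ hN0.le
          linarith [Real.add_one_le_exp (D / L)]
      _ = Real.exp (D * (N / L)) := by rw [← Real.exp_mul]; congr 1; ring
      _ ≤ Real.exp D := Real.exp_le_exp.2
          (mul_le_of_le_one_right (by positivity) ((div_le_one hL0).2 (by linarith)))
  -- The excess factor `L ^ 2` is absorbed into an exponential, `e^(5L) = e^15 (e^10)^N`.
  have hL2 : L ^ 2 ≤ 2 * Real.exp L := by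
    linarith [Real.quadratic_le_exp_of_nonneg hL0.le]
  have hexp : Real.exp (4 * L) * (2 * Real.exp L) = 2 * Real.exp 15 * Real.exp 10 ^ N := by
    rw [← Real.exp_mul, mul_left_comm, ← Real.exp_add, mul_assoc, ← Real.exp_add, hLN]
    congr 2
    ring
  calc ((c / 2) ^ N) ^ 2 / (n.factorial * Real.Gamma (n + α + 1)) ^ 2
      ≤ ((c / 2) ^ N) ^ 2 / (L ^ N / L * Real.exp (-(2 * L))) ^ 2 := by gcongr
    _ = ((c / 2) ^ N) ^ 2 / (L ^ N) ^ 2 * (Real.exp (4 * L) * L ^ 2) := by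
        have : Real.exp (4 * L) = Real.exp (2 * L) ^ 2 := by
          rw [← Real.exp_nat_mul]
          congr 1
          push_cast
          ring
        rw [Real.exp_neg, this]
        field_simp
    _ ≤ ((c / 2) ^ N) ^ 2 / (L ^ N) ^ 2 * (Real.exp (4 * L) * (2 * Real.exp L)) := by gcongr
    _ = 2 * Real.exp 15 * (D / L) ^ N * (Real.exp 1 * c / L) ^ N := by
        have h : (Real.exp 1 * c / L) * (D / L) = (c / 2 / L) * (c / 2 / L) * Real.exp 10 := by
          rw [show (10 : ℝ) = 1 + 9 by norm_num, Real.exp_add, hD]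
          ring
        have h' : (Real.exp 1 * c / L) ^ N * (D / L) ^ N =
            (c / 2) ^ N / L ^ N * ((c / 2) ^ N / L ^ N) * Real.exp 10 ^ N := by
          rw [← Real.mul_rpow (by positivity) (by positivity), h,
            Real.mul_rpow (by positivity) (by positivity),
            Real.mul_rpow (by positivity) (by positivity), Real.div_rpow (by positivity) hL0.le]
        rw [hexp]
        linear_combination (-2 * Real.exp 15) * h'
    _ ≤ 2 * Real.exp 15 * Real.exp D * (Real.exp 1 * c / L) ^ N := by gcongr

end FiniteHankel

theorem theorem2 (c : ℝ) (hc : 0 < c) :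
    ∃ A : ℝ, ∀ (α : ℝ) (hα : -1 / 2 ≤ α) (n : ℕ), Real.exp 1 * c / 4 < (n : ℝ) →
      FiniteHankel.eigenvalue α c hα hc n ≤
        A * (Real.exp 1 * c / (4 * (n : ℝ) + 2 * α + 5)) ^ (2 * (n : ℝ) + α + 1) := by
  refine ⟨16 * Real.exp (c ^ 2 / 2) * (2 * Real.exp 15 * Real.exp (c * Real.exp 9 / 4)),
    fun α hα n hn => (FiniteHankel.eigenvalue_le hα hc n).trans ?_⟩
  have hn1 : 1 ≤ n := by
    have h : 0 < Real.exp 1 * c / 4 := by positivity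
    exact_mod_cast h.trans hn
  rw [mul_div_assoc, mul_assoc (16 * Real.exp (c ^ 2 / 2))]
  exact mul_le_mul_of_nonneg_left (FiniteHankel.rpow_div_factorial_mul_Gamma_le hα hc hn1)
    (by positivity)
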